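/- Let $A$ be an associative ring with $1$, and let $n\ge 0$ be an integer. A left $A$-module $T$ is called a classical $n$-tilting module if: 1. $T$ has a projective resolution $0\to P_n\to\cdots\to P_0\to T\to 0$ with every $P_i$ finitely generated; 2. $\operatorname{Ext}_A^i(T,T)=0$ for every $0<i\le n$; 3. there is an exact sequence $0\to A\to T_0\to\cdots\to T_n\to 0$ in which every $T_i$ is a finitely generated direct summand of a coproduct of copies of $T$. Write $\operatorname{Ext}^0_A=\operatorname{Hom}_A$. For $0\le e\le n$ the Miyashita class is $$KE_e(T)=\{M\in A\text{-Mod} : \operatorname{Ext}_A^i(T,M)=0 \text{ for every } i\ge 0,\ i\ne e\}.$$ For a class $\mathcal S$ of left $A$-modules, let $[\mathcal S]$ be the smallest class of left $A$-modules that contains every quotient of every object of $\mathcal S$ and is closed under extensions. Lo's pairs of classes $(\mathcal T_i,\mathcal F_i)$ are defined, for $0\le i\le n$, by $$\mathcal T_i=\big[\operatorname{Ker}\operatorname{Ext}_A^i(T,?)\cap\cdots\cap\operatorname{Ker}\operatorname{Ext}_A^n(T,?)\big],\qquad \mathcal F_i=\{X : \operatorname{Hom}_A(Y,X)=0 \text{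 for every } Y\in\mathcal T_i\},$$ together with $\mathcal T_{n+1}=A\text{-Mod}$ and $\mathcal F_{n+1}=0$. Then for every classical $n$-tilting left $A$-module $T$ and every $e=0,\dots,n$, $$KE_e(T)\subseteq \mathcal T_{e+1}\cap\mathcal F_e .$$ -/

import Mathlib

open CategoryTheory CategoryTheory.Limits

universe u

namespace ClassicalTilting

variable {A : Type u} [Ring A]

/-- `X` is a direct summand of a coproduct of copies of `T`. -/
def IsSummandOfCopower (T X : ModuleCat.{u} A) : Prop :=
  ∃ (I : Type u) (Y : ModuleCat.{u} A), Nonempty ((X × Y) ≃ₗ[A] (I →₀ T))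

/-- `T` is a classical `n`-tilting (left) `A`-module. -/
structure IsClassicalTilting (n : ℕ) (T : ModuleCat.{u} A) : Prop where
  /-- There is a projective resolution `0 ⟶ P_n ⟶ ⋯ ⟶ P_0 ⟶ T ⟶ 0` with finitely
  generated terms. -/
  exists_resolution : ∃ P : ProjectiveResolution T,
    (∀ i, Module.Finite A (P.complex.X i)) ∧ ∀ i, n < i → IsZero (P.complex.X i)
  /-- `T` is rigid: `Ext^i(T, T) = 0` for `0 < i ≤ n`. -/
  rigid : ∀ i, 0 < i → i ≤ n → Subsingleton (Abelian.Ext T T i)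
  /-- There is an exact sequence `0 ⟶ A ⟶ T_0 ⟶ ⋯ ⟶ T_n ⟶ 0` whose terms `T_i` are finitely
  generated direct summands of coproducts of copies of `T`; the sequence is continued by `0`. -/
  exists_coresolution : ∃ (C : CochainComplex (ModuleCat.{u} A) ℕ) (ε : A →ₗ[A] C.X 0),
    Function.Injective ε ∧
    Function.Exact ε (C.d 0 1).hom ∧
    (∀ i, Function.Exact (C.d i (i + 1)).hom (C.d (i + 1) (i + 2)).hom) ∧
    (∀ i, i ≤ n → Module.Finite A (C.X i) ∧ IsSummandOfCopower T (C.X i)) ∧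
    ∀ i, n < i → IsZero (C.X i)

/-- The kernel of `Ext^i(T, ?)`, as a full subcategory of `A`-Mod (`Ext^0(T, ?)` is
`Hom(T, ?)`). -/
def kerExt (T : ModuleCat.{u} A) (i : ℕ) : ObjectProperty (ModuleCat.{u} A) :=
  fun X ↦ Subsingleton (Abelian.Ext T X i)

/-- The Miyashita class `KE_e(T)`: the modules `X` with `Ext^i(T, X) = 0` for all `i ≠ e`. -/
def miyashitaKE (T : ModuleCat.{u} A) (e : ℕ) : ObjectProperty (ModuleCat.{u} A) :=
  fun X ↦ ∀ i, i ≠ e → kerExt T i X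

/-- The class of all quotients of objects of `S`. -/
def quotients (S : ObjectProperty (ModuleCat.{u} A)) : ObjectProperty (ModuleCat.{u} A) :=
  fun X ↦ ∃ (Y : ModuleCat.{u} A) (f : Y ⟶ X), S Y ∧ Epi f

/-- The extension closure of `S`: the smallest class of modules containing `S` and closed under
extensions. -/
inductive extClosure (S : ObjectProperty (ModuleCat.{u} A)) : ModuleCat.{u} A → Prop
  | of_mem (X : ModuleCat.{u} A) : S X → extClosure S X
  | of_shortExact (E : ShortComplex (ModuleCat.{u} A)) :
      E.ShortExact → extClosure S E.X₁ → extClosure S E.X₃ → extClosure S E.X₂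

/-- Lo's class `𝒯_i = [Ker Ext^i(T, ?) ∩ ⋯ ∩ Ker Ext^n(T, ?)]`, where `[S]` is the extension
closure of the class of quotients of objects of `S`. For `i = n + 1` the intersection is empty
and the class is all of `A`-Mod, see `loT_succ`. -/
def loT (n : ℕ) (T : ModuleCat.{u} A) (i : ℕ) : ObjectProperty (ModuleCat.{u} A) :=
  extClosure (quotients fun X ↦ ∀ j, i ≤ j → j ≤ n → kerExt T j X)

/-- Lo's class `ℱ_i = Ker Hom(𝒯_i, ?)`. For `i = n + 1` it is the class of zero modules, see
`loF_succ`. -/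
def loF (n : ℕ) (T : ModuleCat.{u} A) (i : ℕ) : ObjectProperty (ModuleCat.{u} A) :=
  (loT n T i).rightOrthogonal

theorem loT_succ (n : ℕ) (T : ModuleCat.{u} A) : loT n T (n + 1) = ⊤ := by
  ext X
  refine ⟨fun _ ↦ trivial, fun _ ↦ ?_⟩
  exact .of_mem X ⟨X, 𝟙 X, fun j h₁ h₂ ↦ absurd h₁ (by omega), inferInstance⟩

theorem loF_succ (n : ℕ) (T : ModuleCat.{u} A) : loF n T (n + 1) = IsZero := by
  ext X
  rw [loF, loT_succ, ObjectProperty.rightOrthogonal_iff]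
  exact ⟨fun h ↦ (IsZero.iff_id_eq_zero X).2 (h (𝟙 X) trivial),
    fun h Y f _ ↦ h.eq_of_tgt f 0⟩

end ClassicalTilting

namespace ClassicalTilting

open Abelian

/-! Let `Z^j` be the cocycles of the coresolution `0 → A → T_0 → ⋯ → T_n → 0`, so `Z^0 ≅ A` and
`Z^{n+1} = 0`. Given `f : Y ⟶ M`, iterated connecting maps send `Hom(Z^0, ?)` to `Ext^e(Z^e, ?)`,
naturally in the second argument. For `M` they are injective, as `Ext^j(T, M) = 0` for `j < e`; for
`Y` the target vanishes (`subsingleton_ext_cycles`). Hence `f` kills `Hom(A, Y) = Y`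
(`ext_cycles_comp_eq_zero`). -/

/-- A finitely generated direct summand of a coproduct of copies of `T` is annihilated by
`Ext^j(?, Y)` whenever `T` is. -/
theorem IsSummandOfCopower.subsingleton_ext {A : Type u} [Ring A] {T X Y : ModuleCat.{u} A}
    [Module.Finite A X] (hX : IsSummandOfCopower T X) {j : ℕ}
    (h : Subsingleton (Ext T Y j)) : Subsingleton (Ext X Y j) := by
  classical
  obtain ⟨I, Z, ⟨φ⟩⟩ := hX
  let ι : X →ₗ[A] (I →₀ T) := φ.toLinearMap ∘ₗ LinearMap.inl A X Z
  let π : (I →₀ T) →ₗ[A] X := LinearMap.fst A X Z ∘ₗ φ.symm.toLinearMap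
  have hπι (x : X) : π (ι x) = x := by simp [ι, π]
  obtain ⟨G, hG⟩ := Module.Finite.fg_top (R := A) (M := X)
  -- The supports of finitely many generators put the image of `ι` in a finite subsum, so `𝟙 X` is a
  -- finite sum of maps `X ⟶ T ⟶ X`.
  let s : Finset I := G.biUnion fun x ↦ (ι x).support
  have hs (x : X) : ι x ∈ Finsupp.supported T A (s : Set I) := by
    have hle : Submodule.span A (G : Set X) ≤ (Finsupp.supported T A (s : Set I)).comap ι := by
      rw [Submodule.span_le]
      intro y hy
      exact Finset.coe_subset.2 (Finset.subset_biUnion_of_mem (fun x ↦ (ι x).support) hy)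
    exact hle (hG ▸ Submodule.mem_top)
  let p (i : I) : X ⟶ T := ModuleCat.ofHom (Finsupp.lapply i ∘ₗ ι)
  let q (i : I) : T ⟶ X := ModuleCat.ofHom (π ∘ₗ Finsupp.lsingle i)
  have hid : 𝟙 X = ∑ i : s, p i ≫ q i := by
    ext x
    have hx : ι x = ∑ i : s, Finsupp.single i.1 (ι x i) := by
      rw [Finset.sum_coe_sort s fun i ↦ Finsupp.single i (ι x i)]
      exact (Finsupp.sum_single (ι x)).symm.trans
        (Finsupp.sum_of_support_subset (ι x) (hs x) Finsupp.single fun _ _ ↦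
          Finsupp.single_zero _)
    simp only [ModuleCat.hom_sum, LinearMap.sum_apply]
    conv_lhs => rw [ModuleCat.id_apply, ← hπι x, hx, map_sum]
    rfl
  refine subsingleton_of_forall_eq 0 fun α ↦ ?_
  rw [← Ext.mk₀_id_comp α, hid, Ext.mk₀_sum, Ext.sum_comp]
  refine Finset.sum_eq_zero fun i _ ↦ ?_
  rw [← Ext.mk₀_comp_mk₀_assoc, Subsingleton.elim ((Ext.mk₀ (q i)).comp α (zero_add j)) 0,
    Ext.comp_zero]

section DimensionShifting

variable {C : Type*} [Category C] [CategoryTheory.Abelian C] [HasExt C]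
  {S : ShortComplex C} (hS : S.ShortExact)

include hS

/-- The connecting map `Ext^j(S.X₁, Y) ⟶ Ext^{j+1}(S.X₃, Y)` is injective if
`Ext^j(S.X₂, Y)` vanishes. -/
theorem eq_zero_of_extClass_comp_eq_zero {Y : C} {j k : ℕ} (hk : 1 + j = k)
    (h : Subsingleton (Ext S.X₂ Y j)) (α : Ext S.X₁ Y j)
    (hα : hS.extClass.comp α hk = 0) : α = 0 := by
  obtain ⟨β, rfl⟩ := Ext.contravariant_sequence_exact₁ hS Y α hk hα
  rw [Subsingleton.elim β 0, Ext.comp_zero]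

end DimensionShifting

section Syzygies

variable {A : Type u} [Ring A] (C : CochainComplex (ModuleCat.{u} A) ℕ)

/-- The short complex `Z^i ⟶ C^i ⟶ Z^{i+1}` of a cochain complex of modules. -/
abbrev cyclesShortComplex (i : ℕ) : ShortComplex (ModuleCat.{u} A) where
  X₁ := ModuleCat.of A (LinearMap.ker (C.d i (i + 1)).hom)
  X₂ := C.X i
  X₃ := ModuleCat.of A (LinearMap.ker (C.d (i + 1) (i + 1 + 1)).hom)
  f := ModuleCat.ofHom (LinearMap.ker (C.d i (i + 1)).hom).subtype
  g := ModuleCat.ofHom ((C.d i (i + 1)).hom.codRestrict _ fun x ↦ by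
    rw [LinearMap.mem_ker, ← LinearMap.comp_apply, ← ModuleCat.hom_comp, C.d_comp_d]; rfl)
  zero := by
    ext x
    exact x.2

theorem cyclesShortComplex_shortExact (i : ℕ)
    (h : Function.Exact (C.d i (i + 1)).hom (C.d (i + 1) (i + 1 + 1)).hom) :
    (cyclesShortComplex C i).ShortExact where
  exact := by
    rw [ShortComplex.moduleCat_exact_iff]
    exact fun x hx ↦ ⟨⟨x, congrArg Subtype.val hx⟩, rfl⟩
  mono_f := (ModuleCat.mono_iff_injective _).2 Subtype.val_injective
  epi_g := (ModuleCat.epi_iff_surjective _).2 fun ⟨y, hy⟩ ↦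
    let ⟨x, hx⟩ := (h y).1 hy
    ⟨x, Subtype.ext hx⟩

variable {C} {n e : ℕ} {Y M : ModuleCat.{u} A}
  (hC : ∀ i, Function.Exact (C.d i (i + 1)).hom (C.d (i + 1) (i + 1 + 1)).hom)
include hC

/-- If `C` is exact and vanishes above degree `n`, and `Ext^j(C^j, Y) = 0` for `e ≤ j ≤ n`, then
`Ext^e(Z^e, Y) = 0`. -/
theorem subsingleton_ext_cycles (he : e ≤ n + 1) (hzero : IsZero (C.X (n + 1)))
    (hY : ∀ j, e ≤ j → j ≤ n → Subsingleton (Ext (C.X j) Y j)) :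
    Subsingleton (Ext (cyclesShortComplex C e).X₁ Y e) := by
  induction he using Nat.decreasingInduction with
  | self =>
    -- Here `e = n + 1`, and `Z^{n+1}` is a submodule of `C^{n+1} = 0`.
    have := ModuleCat.subsingleton_of_isZero hzero
    refine subsingleton_of_forall_eq 0 fun α ↦ ?_
    rw [← Ext.mk₀_id_comp α, (ModuleCat.isZero_of_subsingleton _).eq_of_src (𝟙 _) 0,
      Ext.mk₀_zero, Ext.zero_comp]
  | of_succ k hk ih =>
    have := ih fun j h₁ h₂ ↦ hY j (by omega) h₂
    exact subsingleton_of_forall_eq 0 fun α ↦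
      eq_zero_of_extClass_comp_eq_zero (cyclesShortComplex_shortExact C k (hC k)) (add_comm 1 k)
        (hY k le_rfl (by omega)) α
          (Subsingleton.elim (α := Ext (cyclesShortComplex C (k + 1)).X₁ Y (k + 1)) _ _)

/-- If `C` is exact, `Ext^e(Z^e, Y) = 0` and `Ext^j(C^j, M) = 0` for `j < e`, then every morphism
`Y ⟶ M` kills `Ext^j(Z^j, Y)` for `j ≤ e`. -/
theorem ext_cycles_comp_eq_zero (f : Y ⟶ M) {j : ℕ} (hj : j ≤ e)
    (hY : Subsingleton (Ext (cyclesShortComplex C e).X₁ Y e))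
    (hM : ∀ j < e, Subsingleton (Ext (C.X j) M j)) (α : Ext (cyclesShortComplex C j).X₁ Y j) :
    α.comp (Ext.mk₀ f) (add_zero j) = 0 := by
  induction hj using Nat.decreasingInduction with
  | self => rw [Subsingleton.elim α 0, Ext.zero_comp]
  | of_succ k hk ih =>
    have hS := cyclesShortComplex_shortExact C k (hC k)
    refine eq_zero_of_extClass_comp_eq_zero hS (add_comm 1 k) (hM k hk) _ ?_
    -- Postcomposition with `f` commutes with the connecting map.
    rw [← Ext.comp_assoc_of_third_deg_zero]
    exact ih (hS.extClass.comp α (add_comm 1 k))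

end Syzygies

/-- For a classical `n`-tilting module `T`, there are no nonzero morphisms from a module on which
`Ext^j(T, ?)` vanishes for `e ≤ j ≤ n` to a module on which it vanishes for `j < e`. -/
theorem IsClassicalTilting.hom_eq_zero {A : Type u} [Ring A] {n e : ℕ} {T Y M : ModuleCat.{u} A}
    (hT : IsClassicalTilting n T) (he : e ≤ n) (hY : ∀ j, e ≤ j → j ≤ n → kerExt T j Y)
    (hM : ∀ j < e, kerExt T j M) (f : Y ⟶ M) : f = 0 := by
  obtain ⟨C, ε, hε, hε', hC, hadd, hzero⟩ := hT.exists_coresolution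
  have hext {j : ℕ} (hj : j ≤ n) {N : ModuleCat.{u} A} (h : kerExt T j N) :
      Subsingleton (Ext (C.X j) N j) :=
    have := (hadd j hj).1
    (hadd j hj).2.subsingleton_ext h
  have hsub := subsingleton_ext_cycles hC (by omega : e ≤ n + 1) (hzero _ n.lt_succ_self)
    fun j h₁ h₂ ↦ hext h₂ (hY j h₁ h₂)
  let ε' : A ≃ₗ[A] LinearMap.ker (C.d 0 1).hom :=
    .ofInjective ε hε ≪≫ₗ .ofEq _ _ hε'.linearMap_ker_eq.symm
  ext y
  -- Under `Z^0 ≅ A` this is `a ↦ a • y`, so evaluating `g ≫ f = 0` at `1` gives `f y = 0`.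
  let g : (cyclesShortComplex C 0).X₁ ⟶ Y :=
    ModuleCat.ofHom (LinearMap.toSpanSingleton A Y y ∘ₗ ε'.symm.toLinearMap)
  have hg : g ≫ f = 0 := by
    have := ext_cycles_comp_eq_zero hC f (Nat.zero_le e) hsub
      (fun j hj ↦ hext (hj.le.trans he) (hM j hj)) (Ext.mk₀ g)
    rwa [Ext.mk₀_comp_mk₀, Ext.mk₀_eq_zero_iff] at this
  have := ConcreteCategory.congr_hom hg (ε' 1)
  simpa [g] using this

/-- Vanishing of morphisms into `M` passes from a class to the extension closure of its
quotients. -/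
theorem rightOrthogonal_le_rightOrthogonal_extClosure_quotients {A : Type u} [Ring A]
    (S : ObjectProperty (ModuleCat.{u} A)) :
    S.rightOrthogonal ≤ ObjectProperty.rightOrthogonal (extClosure (quotients S)) := by
  intro M hM Y f hY
  induction hY with
  | of_mem Y hY =>
    obtain ⟨Z, p, hZ, hp⟩ := hY
    rw [← cancel_epi p, comp_zero]
    exact hM _ hZ
  | of_shortExact E hE _ _ ih₁ ih₃ =>
    have := hE.epi_g
    -- As `f` vanishes on `E.X₁`, it factors through `E.X₃`.
    obtain ⟨g, rfl⟩ := CokernelCofork.IsColimit.desc' hE.gIsCokernel f (ih₁ (E.f ≫ f))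
    exact (congrArg _ (ih₃ g)).trans comp_zero

end ClassicalTilting

theorem mainTheorem2 {A : Type u} [Ring A] (n : ℕ) (T : ModuleCat.{u} A)
    (hT : ClassicalTilting.IsClassicalTilting n T) (e : ℕ) (he : e ≤ n) :
    ClassicalTilting.miyashitaKE T e ≤
      ClassicalTilting.loT n T (e + 1) ⊓ ClassicalTilting.loF n T e := by
  refine fun M hM ↦ ⟨.of_mem M ⟨M, 𝟙 M, fun j hj _ ↦ hM j (by omega), inferInstance⟩, ?_⟩
  exact ClassicalTilting.rightOrthogonal_le_rightOrthogonal_extClosure_quotients _ M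
    fun Y f hY ↦ hT.hom_eq_zero he hY (fun j hj ↦ hM j hj.ne) f
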